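/- Let $\sigma=\mathrm{Prop}\cup\{R_i\mid i\in I\}$ be a modal signature with a finite set $\mathrm{Prop}$ of unary proposition letters and binary actions $R_i$ indexed by a finite set $I$. A $\sigma$-LTS $M_a$ is a (possibly infinite) $\sigma$-structure $M$ with a distinguished state $a$; it is degree-finite if every state has only finitely many successors and finitely many predecessors along the actions. A homomorphism of $\sigma$-LTSs is a map of states that preserves the distinguished state, the proposition letters and the actions; $\hom_{\mathbb N}(T_c,M_a)\in\mathbb N$ is the number of homomorphisms from $T_c$ to $M_a$, when this is finite. A $\sigma$-path of length $\ell\ge 0$ from $s_0$ to $s_\ell$ consists of states $s_0,\dots,s_\ell$ and binary facts $f_1,\dots,f_\ell$, where each $f_j$ is of the form $R_i(s_{j-1},s_j)$ or $R_i(s_j,s_{j-1})$ for some $i\in I$. A $\sigma$-LTS is connected if there is a $\sigma$-path between any two states, and acyclic if there is no $\sigma$-path of positive length from a state to itself in which no binary fact is repeated. The depth of a connected $\sigma$-LTS is the supremum, over its states $m$, of the length of a shortest $\sigma$-path from the distinguished state to $m$. Let $\mathcal A^k_\sigma$ be the class of finite connected acyclic $\sigma$-LTSs of depth at most $k$. Formulas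 of graded modal logic with graded backward modalities are given by $$\varphi ::= \top\mid p\mid\varphi\wedge\varphi\mid\varphi\vee\varphi\mid\neg\varphi\mid\Diamond_i\varphi\mid\Box_i\varphi\mid\Diamond_i^{\ge n}\varphi\ (n\ge 1)\mid\blacklozenge_i^{\ge n}\varphi\ (n\in\mathbb N),$$ with $p\in\mathrm{Prop}$ and $i\in I$, where $\Diamond_i,\Box_i$ have their usual semantics, and $\Diamond_i^{\ge n}\varphi$ (resp. $\blacklozenge_i^{\ge n}\varphi$) holds at a state if at least $n$ of its $R_i$-successors (resp. $R_i$-predecessors) satisfy $\varphi$. The modal depth of a formula is its maximal nesting of modalities, forward and backward. **Theorem.** Let $M_a$ and $N_b$ be degree-finite $\sigma$-LTSs and let $k\in\mathbb N$. Then for every $T_c\in\mathcal A^k_\sigma$ there are only finitely many homomorphisms from $T_c$ to $M_a$ and from $T_c$ to $N_b$, and the following are equivalent: 1. $\hom_{\mathbb N}(T_c,M_a)=\hom_{\mathbb N}(T_c,N_b)$ for all $T_c\in\mathcal A^k_\sigma$; 2. $M_a$ and $N_b$ satisfy the same formulas of graded modal logic with graded backward modalities of modal depth at most $k$. -/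

import Mathlib

universe uP uI u v w

namespace ModalHom

/-- A labeled transition system over the modal signature with proposition letters `P` and
actions indexed by `I`: a relational structure with one distinguished state. -/
structure LTS (P : Type uP) (I : Type uI) where
  State : Type u
  val : P → State → Prop
  rel : I → State → State → Prop
  point : State

variable {P : Type uP} {I : Type uI}

namespace LTS

/-- The states reachable from `m` by one transition. -/
def succ (M : LTS.{uP, uI, u} P I) (m : M.State) : Set M.State := {n | ∃ i, M.rel i m n}

/-- The states from which `m` is reachable by one transition. -/
def pred (M : LTS.{uP, uI, u} P I) (m : M.State) : Set M.State := {n | ∃ i, M.rel i n m}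

def DegreeFinite (M : LTS.{uP, uI, u} P I) : Prop :=
  ∀ m : M.State, (M.succ m).Finite ∧ (M.pred m).Finite

/-- Homomorphisms of labeled transition systems. -/
@[ext]
structure Hom (M : LTS.{uP, uI, u} P I) (N : LTS.{uP, uI, v} P I) where
  toFun : M.State → N.State
  map_point : toFun M.point = N.point
  map_val : ∀ p m, M.val p m → N.val p (toFun m)
  map_rel : ∀ i m n, M.rel i m n → N.rel i (toFun m) (toFun n)

/-- The homomorphism count over the natural number semiring. It is meaningful
when there are finitely many homomorphisms. -/
noncomputable def homCount (M : LTS.{uP, uI, u} P I) (N : LTS.{uP, uI, v} P I) : ℕ :=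
  Nat.card (Hom M N)

/-- The left homomorphism vector of `M` restricted to the class `C`. -/
noncomputable def leftProfile (C : Set (LTS.{uP, uI, u} P I)) (M : LTS.{uP, uI, v} P I) :
    C → ℕ :=
  fun T => homCount T.1 M

/-- The binary facts `R_i(src, tgt)` of `M`. -/
structure Fact (M : LTS.{uP, uI, u} P I) where
  label : I
  src : M.State
  tgt : M.State
  holds : M.rel label src tgt

/-- `M.IsPath x y l`: the list `l` of binary facts is an undirected path from `x` to `y`.
Consecutive states along the path are the two ends of the corresponding fact,
which may be traversed in either direction. -/
inductive IsPath (M : LTS.{uP, uI, u} P I) : M.State → M.State → List M.Fact → Prop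
  | nil (x : M.State) : IsPath M x x []
  | cons {x y z : M.State} {l : List M.Fact} (f : M.Fact)
      (hf : (f.src = x ∧ f.tgt = y) ∨ (f.src = y ∧ f.tgt = x)) (h : IsPath M y z l) :
      IsPath M x z (f :: l)

def Connected (M : LTS.{uP, uI, u} P I) : Prop :=
  ∀ x y : M.State, ∃ l, M.IsPath x y l

/-- There is no path of positive length from a state to itself without duplicate facts. -/
def Acyclic (M : LTS.{uP, uI, u} P I) : Prop :=
  ∀ (x : M.State) (l : List M.Fact), M.IsPath x x l → l.Nodup → l = []

/-- The length of a shortest undirected path from the distinguished state to `m`. -/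
noncomputable def stateDepth (M : LTS.{uP, uI, u} P I) (m : M.State) : ℕ∞ :=
  ⨅ (l : List M.Fact) (_ : M.IsPath M.point m l), (l.length : ℕ∞)

noncomputable def depth (M : LTS.{uP, uI, u} P I) : ℕ∞ :=
  ⨆ m : M.State, M.stateDepth m

variable (P I) in
/-- The class of finite connected acyclic labeled transition systems of depth at most `k`. -/
def connectedAcyclic (k : ℕ) : Set (LTS.{uP, uI, u} P I) :=
  {T | Finite T.State ∧ T.Connected ∧ T.Acyclic ∧ T.depth ≤ k}

end LTS

variable (P I) in
/-- Formulas of graded modal logic with graded backward modalities. -/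
inductive Formula : Type max uP uI
  | top : Formula
  | letter (p : P) : Formula
  | and (φ ψ : Formula) : Formula
  | or (φ ψ : Formula) : Formula
  | not (φ : Formula) : Formula
  | dia (i : I) (φ : Formula) : Formula
  | box (i : I) (φ : Formula) : Formula
  | diaGe (i : I) (n : ℕ+) (φ : Formula) : Formula
  | backGe (i : I) (n : ℕ) (φ : Formula) : Formula

namespace Formula

/-- The maximal nesting of (forward and backward) modalities. -/
def modalDepth : Formula P I → ℕ
  | top => 0
  | letter _ => 0
  | and φ ψ => max φ.modalDepth ψ.modalDepth
  | or φ ψ => max φ.modalDepth ψ.modalDepth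
  | not φ => φ.modalDepth
  | dia _ φ => φ.modalDepth + 1
  | box _ φ => φ.modalDepth + 1
  | diaGe _ _ φ => φ.modalDepth + 1
  | backGe _ _ φ => φ.modalDepth + 1

/-- Satisfaction of a formula at a state of `M`. -/
def SatAt (M : LTS.{uP, uI, u} P I) : Formula P I → M.State → Prop
  | top, _ => True
  | letter p, m => M.val p m
  | and φ ψ, m => φ.SatAt M m ∧ ψ.SatAt M m
  | or φ ψ, m => φ.SatAt M m ∨ ψ.SatAt M m
  | not φ, m => ¬ φ.SatAt M m
  | dia i φ, m => ∃ n, M.rel i m n ∧ φ.SatAt M n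
  | box i φ, m => ∀ n, M.rel i m n → φ.SatAt M n
  | diaGe i k φ, m => ((k : ℕ) : ℕ∞) ≤ {n | M.rel i m n ∧ φ.SatAt M n}.encard
  | backGe i k φ, m => (k : ℕ∞) ≤ {n | M.rel i n m ∧ φ.SatAt M n}.encard

end Formula

namespace LTS

/-- `M` satisfies `φ` at its distinguished state. -/
def Sat (M : LTS.{uP, uI, u} P I) (φ : Formula P I) : Prop := φ.SatAt M M.point

/-- `M` and `N` satisfy the same formulas of modal depth at most `k`. -/
def ModalEquiv (k : ℕ) (M : LTS.{uP, uI, u} P I) (N : LTS.{uP, uI, v} P I) : Prop :=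
  ∀ φ : Formula P I, φ.modalDepth ≤ k → (M.Sat φ ↔ N.Sat φ)

end LTS

end ModalHom

/-!
Both conditions say that the distinguished states are graded bisimilar up to depth `k`: they
carry the same letters and, if `k > 0`, for every action and either direction the neighbours of
one are in bijection with the neighbours of the other, corresponding neighbours being graded
bisimilar up to depth `k - 1`. Such a bisimilarity clearly preserves homomorphism counts from trees
and truth of formulas. Conversely, counting functions of trees are closed under products (glue the
roots), and so are indicator functions of formulas (take conjunctions). Hence the values at a state
form a character of a commutative monoid. Distinct characters are linearly independent, so a finite
family of states is determined, up to a bijection that preserves all values, by the sums of these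
values over the family; and summing over neighbours is one more edge, or one more graded modality.

Trees describe all finite connected acyclic systems: in an acyclic system every fact is the only one
to cross some cut, and cutting along a fact at the distinguished state leaves two smaller systems.
-/

namespace ModalHom

theorem exists_equiv_of_sum_monoidHom_eq {G R X Y : Type*} [Monoid G] [CommRing R]
    [IsDomain R] [CharZero R] [Fintype X] [Fintype Y] (u : X → G →* R) (v : Y → G →* R)
    (h : ∀ g, ∑ x, u x g = ∑ y, v y g) : ∃ e : X ≃ Y, ∀ x, v (e x) = u x := by
  classical
  have hsum : ∑ x, Finsupp.single (u x) (1 : R) = ∑ y, Finsupp.single (v y) (1 : R) := by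
    apply linearIndependent_monoidHom G R
    ext g
    simpa only [map_sum, Finsupp.linearCombination_single, one_smul, Finset.sum_apply] using h g
  have hfiber (c : G →* R) : Fintype.card {x // u x = c} = Fintype.card {y // v y = c} := by
    simpa [Finsupp.finsetSum_apply, Finsupp.single_apply, Fintype.card_subtype] using
      DFunLike.congr_fun hsum c
  exact ⟨Equiv.ofFiberEquiv fun c => Fintype.equivOfCardEq (hfiber c), Equiv.ofFiberEquiv_map _⟩

theorem exists_equiv_of_finsum_eq {ι X Y : Type*} [Finite X] [Finite Y] (a : ι → X → ℕ)
    (b : ι → Y → ℕ) (hone : ∃ i, a i = 1 ∧ b i = 1)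
    (hmul : ∀ i j, ∃ l, a l = a i * a j ∧ b l = b i * b j)
    (hsum : ∀ i, ∑ᶠ x, a i x = ∑ᶠ y, b i y) : ∃ e : X ≃ Y, ∀ x i, a i x = b i (e x) := by
  have := Fintype.ofFinite X
  have := Fintype.ofFinite Y
  simp only [finsum_eq_sum_of_fintype] at hsum
  let G : Submonoid ((X → ℕ) × (Y → ℕ)) :=
    { carrier := Set.range fun i => (a i, b i)
      one_mem' := hone.imp fun _ h => Prod.ext h.1 h.2
      mul_mem' := by
        rintro _ _ ⟨i, rfl⟩ ⟨j, rfl⟩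
        exact (hmul i j).imp fun _ h => Prod.ext h.1 h.2 }
  let cast : ℕ →* ℤ := (Nat.castRingHom ℤ).toMonoidHom
  let u (x : X) : G →* ℤ :=
    cast.comp ((Pi.evalMonoidHom _ x).comp ((MonoidHom.fst _ _).comp G.subtype))
  let v (y : Y) : G →* ℤ :=
    cast.comp ((Pi.evalMonoidHom _ y).comp ((MonoidHom.snd _ _).comp G.subtype))
  have huv : ∀ g, ∑ x, u x g = ∑ y, v y g := by
    rintro ⟨_, i, rfl⟩
    change ∑ x, (a i x : ℤ) = ∑ y, (b i y : ℤ)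
    exact_mod_cast hsum i
  obtain ⟨e, he⟩ := exists_equiv_of_sum_monoidHom_eq u v huv
  refine ⟨e, fun x i => ?_⟩
  have hx : (b i (e x) : ℤ) = a i x := DFunLike.congr_fun (he x) ⟨_, i, rfl⟩
  exact_mod_cast hx.symm

theorem encard_sep_congr {α β : Type*} {s : Set α} {t : Set β} (e : s ≃ t) {p : α → Prop}
    {q : β → Prop} (h : ∀ x : s, p x ↔ q (e x)) :
    {x | x ∈ s ∧ p x}.encard = {y | y ∈ t ∧ q y}.encard :=
  ENat.card_congr <| (Equiv.subtypeSubtypeEquivSubtypeInter (· ∈ s) p).symm.trans <|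
    (e.subtypeEquiv h).trans (Equiv.subtypeSubtypeEquivSubtypeInter (· ∈ t) q)

open Classical in
theorem encard_sep_eq_finsum {α : Type*} (s : Set α) [Finite s] (p : α → Prop) :
    {x | x ∈ s ∧ p x}.encard = ((∑ᶠ x : s, if p x then 1 else 0 : ℕ) : ℕ∞) := by
  have := Fintype.ofFinite s
  rw [finsum_eq_sum_of_fintype, Finset.sum_boole, Nat.cast_id, ← Fintype.card_subtype,
    ← ENat.card_eq_coe_fintype_card]
  exact ENat.card_congr (Equiv.subtypeSubtypeEquivSubtypeInter (· ∈ s) p).symm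

variable {P : Type uP} {I : Type uI}

namespace LTS

/-- The neighbours of `m` along an action that is traversed forward (`true`) or backward
(`false`). -/
def step (M : LTS.{uP, uI, u} P I) : I × Bool → M.State → Set M.State
  | (i, true), m => {n | M.rel i m n}
  | (i, false), m => {n | M.rel i n m}

/-- Every state has finitely many successors and finitely many predecessors along each action. If
there are infinitely many actions, this is weaker than `DegreeFinite`. -/
def ImageFinite (M : LTS.{uP, uI, u} P I) : Prop :=
  ∀ j m, Finite (M.step j m)

theorem DegreeFinite.imageFinite {M : LTS.{uP, uI, u} P I} (hM : M.DegreeFinite) :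
    M.ImageFinite := by
  rintro ⟨i, _ | _⟩ m
  · exact (hM m).2.subset fun n hn => ⟨i, hn⟩
  · exact (hM m).1.subset fun n hn => ⟨i, hn⟩

end LTS

/-- Graded bisimilarity up to depth `k` with respect to the actions and their converses. -/
def GradedBisim (M : LTS.{uP, uI, u} P I) (N : LTS.{uP, uI, v} P I) :
    ℕ → M.State → N.State → Prop
  | 0, m, n => ∀ p, M.val p m ↔ N.val p n
  | k + 1, m, n => (∀ p, M.val p m ↔ N.val p n) ∧
      ∀ j, ∃ e : M.step j m ≃ N.step j n, ∀ x : M.step j m, GradedBisim M N k x (e x)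

variable (P I) in
/-- Finite rooted trees, encoded as terms: a root with a set of letters, or a tree `t` with a
further tree `t'` attached to its root by an edge. -/
inductive Tree : Type max uP uI
  | leaf (S : Set P) : Tree
  | graft (t : Tree) (j : I × Bool) (t' : Tree) : Tree

namespace Tree

/-- The height of the tree. -/
def depth : Tree P I → ℕ
  | leaf _ => 0
  | graft t _ t' => max t.depth (t'.depth + 1)

open Classical in
/-- The number of homomorphisms of a tree that send the root to `m`, computed by recursion on the
tree (see `homCount_toLTS`). -/
noncomputable def count (M : LTS.{uP, uI, u} P I) : Tree P I → M.State → ℕ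
  | leaf S, m => if ∀ p ∈ S, M.val p m then 1 else 0
  | graft t j t', m => t.count M m * ∑ᶠ n : M.step j m, t'.count M n

/-- The tree `t` with the letters `S` added to its root. -/
def addLetters (S : Set P) : Tree P I → Tree P I
  | leaf S' => leaf (S ∪ S')
  | graft t j t' => graft (t.addLetters S) j t'

/-- The tree obtained by identifying the roots of two trees. -/
def glue (t : Tree P I) : Tree P I → Tree P I
  | leaf S => t.addLetters S
  | graft t₁ j t' => graft (t.glue t₁) j t'

theorem depth_addLetters (S : Set P) (t : Tree P I) : (t.addLetters S).depth = t.depth := by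
  induction t with
  | leaf _ => rfl
  | graft t j t' ih _ => simp only [addLetters, depth, ih]

theorem depth_glue (t t' : Tree P I) : (t.glue t').depth = max t.depth t'.depth := by
  induction t' with
  | leaf S => simp only [glue, depth, depth_addLetters, zero_le, max_eq_left]
  | graft t₁ j t' ih _ => simp only [glue, depth, ih, max_assoc]

section Count

variable {M : LTS.{uP, uI, u} P I} {N : LTS.{uP, uI, v} P I}

theorem count_leaf_empty (m : M.State) : (leaf ∅ : Tree P I).count M m = 1 := by
  simp [count]

theorem count_graft_leaf_empty (j : I × Bool) (t : Tree P I) (m : M.State) :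
    (graft (leaf ∅) j t).count M m = ∑ᶠ n : M.step j m, t.count M n := by
  rw [count, count_leaf_empty, one_mul]

theorem val_iff_of_count_leaf_eq {p : P} {m : M.State} {n : N.State}
    (h : (leaf {p} : Tree P I).count M m = (leaf {p} : Tree P I).count N n) :
    M.val p m ↔ N.val p n := by
  simp only [count] at h
  split_ifs at h with hm hn hn
  · exact iff_of_true (hm p rfl) (hn p rfl)
  · simpa only [Set.mem_singleton_iff, forall_eq] using iff_of_false hm hn

theorem count_addLetters (S : Set P) (t : Tree P I) (m : M.State) :
    (t.addLetters S).count M m = t.count M m * (leaf S : Tree P I).count M m := by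
  induction t with
  | leaf S' =>
    classical
    have hunion : (∀ p ∈ S ∪ S', M.val p m) ↔ (∀ p ∈ S', M.val p m) ∧ ∀ p ∈ S, M.val p m := by
      simp only [Set.mem_union, or_imp, forall_and, and_comm]
    by_cases h : ∀ p ∈ S, M.val p m
    · simp only [addLetters, count, if_pos h, mul_one]
      exact if_congr (hunion.trans (and_iff_left h)) rfl rfl
    · simp only [addLetters, count, if_neg h, mul_zero]
      exact if_neg fun h' => h (hunion.1 h').2
  | graft t j t' ih _ =>
    simp only [addLetters, count, ih]
    ring

theorem count_glue (t t' : Tree P I) (m : M.State) :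
    (t.glue t').count M m = t.count M m * t'.count M m := by
  induction t' with
  | leaf S => exact count_addLetters S t m
  | graft t₁ j t' ih _ => simp only [glue, count, ih, mul_assoc]

end Count

end Tree

namespace Formula

/-- The formula saying that at least `c` neighbours along `j` satisfy `φ`. The forward case `c = 0`
is treated apart because `diaGe` only takes positive numbers. -/
def stepGe : I × Bool → ℕ → Formula P I → Formula P I
  | (_, true), 0, _ => top
  | (i, true), c + 1, φ => diaGe i c.succPNat φ
  | (i, false), c, φ => backGe i c φ

open Classical in
theorem ite_satAt_and {M : LTS.{uP, uI, u} P I} {φ ψ : Formula P I} {m : M.State} :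
    (if (φ.and ψ).SatAt M m then 1 else 0) =
      (if φ.SatAt M m then 1 else 0) * if ψ.SatAt M m then 1 else 0 := by
  rw [ite_zero_mul_ite_zero, mul_one]
  exact if_congr Iff.rfl rfl rfl

theorem modalDepth_stepGe_le (j : I × Bool) (c : ℕ) (φ : Formula P I) :
    (stepGe j c φ).modalDepth ≤ φ.modalDepth + 1 := by
  obtain ⟨i, _ | _⟩ := j
  · exact le_rfl
  · cases c with
    | zero => exact Nat.zero_le _
    | succ c => exact le_rfl

theorem satAt_stepGe {M : LTS.{uP, uI, u} P I} {j : I × Bool} {c : ℕ} {φ : Formula P I}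
    {m : M.State} :
    (stepGe j c φ).SatAt M m ↔ (c : ℕ∞) ≤ {n | n ∈ M.step j m ∧ φ.SatAt M n}.encard := by
  obtain ⟨i, _ | _⟩ := j
  · rfl
  · cases c with
    | zero => exact iff_of_true trivial bot_le
    | succ c => rfl

open Classical in
theorem satAt_stepGe_iff_le_finsum {M : LTS.{uP, uI, u} P I} (hM : M.ImageFinite) {j : I × Bool}
    {c : ℕ} {φ : Formula P I} {m : M.State} :
    (stepGe j c φ).SatAt M m ↔ c ≤ ∑ᶠ n : M.step j m, if φ.SatAt M n then 1 else 0 := by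
  have := hM j m
  rw [satAt_stepGe, encard_sep_eq_finsum, Nat.cast_le]

end Formula

namespace GradedBisim

variable {M : LTS.{uP, uI, u} P I} {N : LTS.{uP, uI, v} P I} {k : ℕ} {m : M.State} {n : N.State}

theorem val_iff (h : GradedBisim M N k m n) (p : P) : M.val p m ↔ N.val p n := by
  cases k with
  | zero => exact h p
  | succ k => exact h.1 p

theorem count_eq (h : GradedBisim M N k m n) {t : Tree P I} (ht : t.depth ≤ k) :
    t.count M m = t.count N n := by
  induction t generalizing k m n with
  | leaf S =>
    classical
    exact if_congr (forall₂_congr fun p _ => h.val_iff p) rfl rfl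
  | graft t j t' ih ih' =>
    obtain ⟨ht, ht'⟩ := max_le_iff.1 ht
    obtain ⟨k, rfl⟩ := Nat.exists_eq_add_of_le' (Nat.one_le_of_lt ht')
    obtain ⟨e, he⟩ := h.2 j
    have hsum : ∑ᶠ x : M.step j m, t'.count M x = ∑ᶠ y : N.step j n, t'.count N y :=
      finsum_eq_of_bijective e e.bijective fun x => ih' (he x) (Nat.le_of_succ_le_succ ht')
    simp only [Tree.count, ih h ht, hsum]

theorem satAt_iff (h : GradedBisim M N k m n) {φ : Formula P I} (hφ : φ.modalDepth ≤ k) :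
    φ.SatAt M m ↔ φ.SatAt N n := by
  have neighbours {k} {m : M.State} {n : N.State} {φ : Formula P I} (h : GradedBisim M N k m n)
      (hφ : φ.modalDepth + 1 ≤ k)
      (ih : ∀ {k} {m : M.State} {n : N.State}, GradedBisim M N k m n → φ.modalDepth ≤ k →
        (φ.SatAt M m ↔ φ.SatAt N n)) (j : I × Bool) :
      ∃ e : M.step j m ≃ N.step j n, ∀ x : M.step j m, φ.SatAt M x ↔ φ.SatAt N (e x) := by
    obtain ⟨k, rfl⟩ := Nat.exists_eq_add_of_le' (Nat.one_le_of_lt hφ)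
    exact (h.2 j).imp fun e he x => ih (he x) (Nat.le_of_succ_le_succ hφ)
  induction φ generalizing k m n with
  | top => rfl
  | letter p => exact h.val_iff p
  | and φ ψ ih ih' => exact and_congr (ih h (max_le_iff.1 hφ).1) (ih' h (max_le_iff.1 hφ).2)
  | or φ ψ ih ih' => exact or_congr (ih h (max_le_iff.1 hφ).1) (ih' h (max_le_iff.1 hφ).2)
  | not φ ih => exact not_congr (ih h hφ)
  | dia i φ ih =>
    obtain ⟨e, he⟩ := neighbours h hφ ih (i, true)
    have hex := e.exists_congr (p := fun x => φ.SatAt M x.1) (q := fun y => φ.SatAt N y.1) he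
    simp only [Subtype.exists, exists_prop] at hex
    exact hex
  | box i φ ih =>
    obtain ⟨e, he⟩ := neighbours h hφ ih (i, true)
    exact Subtype.forall'.trans ((e.forall_congr he).trans Subtype.forall'.symm)
  | diaGe i c φ ih =>
    obtain ⟨e, he⟩ := neighbours h hφ ih (i, true)
    exact iff_of_eq (congrArg _ (encard_sep_congr e he))
  | backGe i c φ ih =>
    obtain ⟨e, he⟩ := neighbours h hφ ih (i, false)
    exact iff_of_eq (congrArg _ (encard_sep_congr e he))

theorem of_count_eq (hM : M.ImageFinite) (hN : N.ImageFinite)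
    (h : ∀ t : Tree P I, t.depth ≤ k → t.count M m = t.count N n) : GradedBisim M N k m n := by
  have hval (p : P) : M.val p m ↔ N.val p n :=
    Tree.val_iff_of_count_leaf_eq (h (.leaf {p}) (Nat.zero_le k))
  induction k generalizing m n with
  | zero => exact hval
  | succ k ih =>
    refine ⟨hval, fun j => ?_⟩
    have := hM j m
    have := hN j n
    have hsum (t : {t : Tree P I // t.depth ≤ k}) :
        ∑ᶠ x : M.step j m, t.1.count M x = ∑ᶠ y : N.step j n, t.1.count N y := by
      simpa only [Tree.count_graft_leaf_empty] using
        h (.graft (.leaf ∅) j t.1) (max_le (Nat.zero_le _) (Nat.add_le_add_right t.2 1))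
    obtain ⟨e, he⟩ := exists_equiv_of_finsum_eq
      (fun (t : {t : Tree P I // t.depth ≤ k}) (x : M.step j m) => t.1.count M x)
      (fun t (y : N.step j n) => t.1.count N y)
      ⟨⟨.leaf ∅, Nat.zero_le k⟩, funext fun _ => Tree.count_leaf_empty _,
        funext fun _ => Tree.count_leaf_empty _⟩
      (fun t t' => ⟨⟨t.1.glue t'.1, (Tree.depth_glue _ _).trans_le (max_le t.2 t'.2)⟩,
        funext fun _ => Tree.count_glue _ _ _, funext fun _ => Tree.count_glue _ _ _⟩) hsum
    exact ⟨e, fun x => ih (fun t ht => he x ⟨t, ht⟩)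
      fun p => Tree.val_iff_of_count_leaf_eq (he x ⟨.leaf {p}, Nat.zero_le k⟩)⟩

theorem of_satAt_iff (hM : M.ImageFinite) (hN : N.ImageFinite)
    (h : ∀ φ : Formula P I, φ.modalDepth ≤ k → (φ.SatAt M m ↔ φ.SatAt N n)) :
    GradedBisim M N k m n := by
  classical
  induction k generalizing m n with
  | zero => exact fun p => h (.letter p) le_rfl
  | succ k ih =>
    refine ⟨fun p => h (.letter p) (Nat.zero_le _), fun j => ?_⟩
    have := hM j m
    have := hN j n
    have hsum (φ : {φ : Formula P I // φ.modalDepth ≤ k}) :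
        (∑ᶠ x : M.step j m, if φ.1.SatAt M x then 1 else 0) =
          ∑ᶠ y : N.step j n, if φ.1.SatAt N y then 1 else 0 := by
      refine eq_of_forall_le_iff fun c => ?_
      rw [← Formula.satAt_stepGe_iff_le_finsum hM, ← Formula.satAt_stepGe_iff_le_finsum hN]
      exact h _ ((Formula.modalDepth_stepGe_le j c φ.1).trans (Nat.add_le_add_right φ.2 1))
    obtain ⟨e, he⟩ := exists_equiv_of_finsum_eq
      (fun (φ : {φ : Formula P I // φ.modalDepth ≤ k}) (x : M.step j m) =>
        if φ.1.SatAt M x then 1 else 0)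
      (fun φ (y : N.step j n) => if φ.1.SatAt N y then 1 else 0)
      ⟨⟨.top, Nat.zero_le k⟩, funext fun _ => if_pos trivial, funext fun _ => if_pos trivial⟩
      (fun φ ψ => ⟨⟨.and φ.1 ψ.1, max_le φ.2 ψ.2⟩,
        funext fun _ => Formula.ite_satAt_and, funext fun _ => Formula.ite_satAt_and⟩) hsum
    refine ⟨e, fun x => ih fun φ hφ => ?_⟩
    have hx := he x ⟨φ, hφ⟩
    split_ifs at hx with hφM hφN hφN
    · exact iff_of_true hφM hφN
    · exact iff_of_false hφM hφN

end GradedBisim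

namespace LTS

attribute [ext] Fact

section Paths

variable {M : LTS.{uP, uI, u} P I} {N : LTS.{uP, uI, v} P I} {x y z : M.State}
  {l l' : List M.Fact}

theorem IsPath.append (h : M.IsPath x y l) (h' : M.IsPath y z l') : M.IsPath x z (l ++ l') := by
  induction h with
  | nil x => exact h'
  | cons f hf _ ih => exact .cons f hf (ih h')

theorem IsPath.reverse (h : M.IsPath x y l) : M.IsPath y x l.reverse := by
  induction h with
  | nil x => exact .nil x
  | cons f hf _ ih =>
    rw [List.reverse_cons]
    exact ih.append (.cons f hf.symm (.nil _))

theorem IsPath.exists_of_append (h : M.IsPath x z (l ++ l')) :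
    ∃ y, M.IsPath x y l ∧ M.IsPath y z l' := by
  induction l generalizing x with
  | nil => exact ⟨x, .nil x, h⟩
  | cons f l ih =>
    cases h with
    | cons _ hf h =>
      obtain ⟨y, hl, hl'⟩ := ih h
      exact ⟨y, .cons f hf hl, hl'⟩

theorem IsPath.exists_nodup (h : M.IsPath x z l) : ∃ l' ⊆ l, M.IsPath x z l' ∧ l'.Nodup := by
  induction h with
  | nil x => exact ⟨[], List.Subset.refl _, .nil x, List.nodup_nil⟩
  | @cons x y z l f hf _ ih =>
    obtain ⟨l', hsub, h, hnodup⟩ := ih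
    by_cases hmem : f ∈ l'
    · obtain ⟨l₁, l₂, rfl⟩ := List.append_of_mem hmem
      obtain ⟨c, -, h⟩ := h.exists_of_append
      have hnodup : (f :: l₂).Nodup := (List.nodup_append.1 hnodup).2.1
      have hsub : f :: l₂ ⊆ f :: l :=
        List.subset_cons_of_subset f (List.Subset.trans (List.subset_append_right l₁ _) hsub)
      cases h with
      | @cons _ d _ _ _ hf' h =>
        -- One end of `f` is `x`, so the path can start with `f` or right after it.
        obtain rfl | rfl : c = x ∨ d = x := by grind
        · exact ⟨f :: l₂, hsub, .cons f hf' h, hnodup⟩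
        · exact ⟨l₂, List.Subset.trans (List.subset_cons_self f l₂) hsub, h, hnodup.of_cons⟩
    · exact ⟨f :: l', List.cons_subset_cons f hsub, .cons f hf h, hnodup.cons hmem⟩

theorem IsPath.mem_iff_mem {S : Set M.State} (h : M.IsPath x y l)
    (hl : ∀ f ∈ l, f.src ∈ S ↔ f.tgt ∈ S) : x ∈ S ↔ y ∈ S := by
  induction h with
  | nil x => rfl
  | cons f hf _ ih =>
    have hS := hl f List.mem_cons_self
    have ih := ih fun g hg => hl g (List.mem_cons_of_mem _ hg)
    rcases hf with ⟨rfl, rfl⟩ | ⟨rfl, rfl⟩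
    · exact hS.trans ih
    · exact hS.symm.trans ih

/-- The set `S` contains `x` but not `y`, and no transition other than the one from `x` to `y`
along `i` joins `S` to its complement. -/
def IsCut (M : LTS.{uP, uI, u} P I) (S : Set M.State) (i : I) (x y : M.State) : Prop :=
  x ∈ S ∧ y ∉ S ∧ ∀ i' x' y', M.rel i' x' y' → (x' ∈ S ↔ y' ∈ S) ∨ i' = i ∧ x' = x ∧ y' = y

theorem acyclic_of_exists_isCut (h : ∀ i x y, M.rel i x y → ∃ S, M.IsCut S i x y) :
    M.Acyclic := by
  intro x l hl hnodup
  cases hl with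
  | nil => rfl
  | @cons _ y _ l f hf hl =>
    exfalso
    obtain ⟨S, hsrc, htgt, hS⟩ := h _ _ _ f.holds
    have hyx : y ∈ S ↔ x ∈ S := hl.mem_iff_mem fun g hg =>
      (hS _ _ _ g.holds).resolve_right fun ⟨hlabel, hsrc, htgt⟩ =>
        (List.nodup_cons.1 hnodup).1 (Fact.ext hlabel hsrc htgt ▸ hg)
    rcases hf with ⟨rfl, rfl⟩ | ⟨rfl, rfl⟩
    · exact htgt (hyx.2 hsrc)
    · exact htgt (hyx.1 hsrc)

theorem Acyclic.exists_isCut (hM : M.Acyclic) {i : I} (h : M.rel i x y) :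
    ∃ S, M.IsCut S i x y := by
  let f : M.Fact := ⟨i, x, y, h⟩
  refine ⟨{z | ∃ l, f ∉ l ∧ M.IsPath x z l}, ⟨[], List.not_mem_nil, .nil x⟩, ?_,
    fun i' x' y' h' => or_iff_not_imp_right.2 fun hne => ?_⟩
  · rintro ⟨l, hfl, hl⟩
    obtain ⟨l', hsub, hl', hnodup⟩ := hl.exists_nodup
    exact List.cons_ne_nil f l'
      (hM y _ (.cons f (.inr ⟨rfl, rfl⟩) hl') (hnodup.cons fun hfl' => hfl (hsub hfl')))
  · let g : M.Fact := ⟨i', x', y', h'⟩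
    have hfg : f ≠ g := fun hfg => hne (Fact.ext_iff.1 hfg.symm)
    have hfl {l} (hfl : f ∉ l) : f ∉ l ++ [g] := by simp [hfl, hfg]
    exact ⟨fun ⟨l, hl, hx'⟩ => ⟨l ++ [g], hfl hl, hx'.append (.cons g (.inl ⟨rfl, rfl⟩) (.nil y'))⟩,
      fun ⟨l, hl, hy'⟩ => ⟨l ++ [g], hfl hl, hy'.append (.cons g (.inr ⟨rfl, rfl⟩) (.nil x'))⟩⟩

theorem Acyclic.of_injective {e : M.State → N.State} (he : Function.Injective e)
    (hrel : ∀ i m n, M.rel i m n → N.rel i (e m) (e n)) (hN : N.Acyclic) : M.Acyclic := by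
  refine acyclic_of_exists_isCut fun i x y h => ?_
  obtain ⟨S, hx, hy, hS⟩ := hN.exists_isCut (hrel _ _ _ h)
  exact ⟨e ⁻¹' S, hx, hy, fun i' x' y' h' => (hS _ _ _ (hrel _ _ _ h')).imp_right
    fun ⟨hi, hx, hy⟩ => ⟨hi, he hx, he hy⟩⟩

theorem Acyclic.exists_cut_of_mem_step (hM : M.Acyclic) {j : I × Bool} (h : y ∈ M.step j x) :
    ∃ S : Set M.State, x ∈ S ∧ y ∉ S ∧
      ∀ a ∈ S, ∀ b ∉ S, ∀ j', b ∈ M.step j' a ↔ j' = j ∧ a = x ∧ b = y := by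
  suffices ∃ S : Set M.State, x ∈ S ∧ y ∉ S ∧
      ∀ a ∈ S, ∀ b ∉ S, ∀ j', b ∈ M.step j' a → j' = j ∧ a = x ∧ b = y by
    obtain ⟨S, hx, hy, hS⟩ := this
    refine ⟨S, hx, hy, fun a ha b hb j' => ⟨hS a ha b hb j', ?_⟩⟩
    rintro ⟨rfl, rfl, rfl⟩
    exact h
  obtain ⟨i, _ | _⟩ := j
  · obtain ⟨S, hy, hx, hS⟩ := hM.exists_isCut (i := i) h
    refine ⟨Sᶜ, hx, not_not.2 hy, ?_⟩
    rintro a ha b hb ⟨i', _ | _⟩ hab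
    · have := hS i' b a hab
      grind
    · have := hS i' a b hab
      grind
  · obtain ⟨S, hx, hy, hS⟩ := hM.exists_isCut (i := i) h
    refine ⟨S, hx, hy, ?_⟩
    rintro a ha b hb ⟨i', _ | _⟩ hab
    · have := hS i' b a hab
      grind
    · have := hS i' a b hab
      grind

end Paths

section Depth

variable {M : LTS.{uP, uI, u} P I} {N : LTS.{uP, uI, v} P I}

theorem stateDepth_le_iff {m : M.State} {n : ℕ} :
    M.stateDepth m ≤ n ↔ ∃ l, M.IsPath M.point m l ∧ l.length ≤ n := by
  simp only [stateDepth, ← ENat.lt_natCast_add_one_iff, iInf_lt_iff, exists_prop]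
  norm_cast
  simp only [Nat.lt_succ_iff]

theorem stateDepth_point : M.stateDepth M.point = 0 :=
  nonpos_iff_eq_zero.1 (stateDepth_le_iff.2 ⟨[], .nil _, le_rfl⟩)

theorem IsPath.stateDepth_le {x y : M.State} {l : List M.Fact} (h : M.IsPath x y l) :
    M.stateDepth y ≤ M.stateDepth x + l.length := by
  cases hx : M.stateDepth x with
  | top => exact le_top
  | coe n =>
    obtain ⟨l', hl', hn⟩ := stateDepth_le_iff.1 hx.le
    exact_mod_cast stateDepth_le_iff.2 ⟨_, hl'.append h, by simpa using hn⟩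

theorem stateDepth_le_of_rel {i : I} {x y : M.State} (h : M.rel i x y) :
    M.stateDepth y ≤ M.stateDepth x + 1 ∧ M.stateDepth x ≤ M.stateDepth y + 1 :=
  ⟨(IsPath.cons ⟨i, x, y, h⟩ (.inl ⟨rfl, rfl⟩) (.nil y)).stateDepth_le,
    (IsPath.cons ⟨i, x, y, h⟩ (.inr ⟨rfl, rfl⟩) (.nil x)).stateDepth_le⟩

theorem stateDepth_le_of_mem_step {j : I × Bool} {x y : M.State} (h : y ∈ M.step j x) :
    M.stateDepth y ≤ M.stateDepth x + 1 := by
  obtain ⟨i, _ | _⟩ := j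
  · exact (stateDepth_le_of_rel h).2
  · exact (stateDepth_le_of_rel h).1

theorem IsPath.le_add_length {d : M.State → ℕ∞}
    (hd : ∀ i x y, M.rel i x y → d y ≤ d x + 1 ∧ d x ≤ d y + 1) {x y : M.State}
    {l : List M.Fact} (h : M.IsPath x y l) : d y ≤ d x + l.length := by
  induction h with
  | nil x => rw [List.length_nil, Nat.cast_zero, add_zero]
  | @cons x y z l f hf _ ih =>
    have hxy : d y ≤ d x + 1 := by
      rcases hf with ⟨rfl, rfl⟩ | ⟨rfl, rfl⟩
      · exact (hd _ _ _ f.holds).1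
      · exact (hd _ _ _ f.holds).2
    calc d z ≤ d y + l.length := ih
      _ ≤ d x + 1 + l.length := by gcongr
      _ = d x + (f :: l).length := by
        rw [List.length_cons, Nat.cast_succ, add_assoc, add_comm 1]

theorem le_add_stateDepth {d : M.State → ℕ∞}
    (hd : ∀ i x y, M.rel i x y → d y ≤ d x + 1 ∧ d x ≤ d y + 1) (m : M.State) :
    d m ≤ d M.point + M.stateDepth m := by
  cases hm : M.stateDepth m with
  | top => simp only [add_top, le_top]
  | coe n =>
    obtain ⟨l, hl, hn⟩ := stateDepth_le_iff.1 hm.le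
    exact (hl.le_add_length hd).trans (by gcongr)

theorem stateDepth_map_le {e : M.State → N.State}
    (he : ∀ i m n, M.rel i m n → N.rel i (e m) (e n)) (m : M.State) :
    N.stateDepth (e m) ≤ N.stateDepth (e M.point) + M.stateDepth m :=
  le_add_stateDepth (d := fun m => N.stateDepth (e m))
    (fun _ _ _ h => stateDepth_le_of_rel (he _ _ _ h)) m

theorem mem_connectedAcyclic_iff {k : ℕ} :
    M ∈ connectedAcyclic P I k ↔ Finite M.State ∧ M.Acyclic ∧ M.depth ≤ k := by
  refine ⟨fun h => ⟨h.1, h.2.2⟩, fun h => ⟨h.1, fun x y => ?_, h.2⟩⟩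
  have hpath (z : M.State) : ∃ l, M.IsPath M.point z l ∧ l.length ≤ k :=
    stateDepth_le_iff.1 ((le_iSup M.stateDepth z).trans h.2.2)
  obtain ⟨l, hx, -⟩ := hpath x
  obtain ⟨l', hy, -⟩ := hpath y
  exact ⟨_, hx.reverse.append hy⟩

theorem eq_point_of_forall_step_eq_empty (h : ∀ j, M.step j M.point = ∅) (hM : M.depth < ⊤)
    (m : M.State) : m = M.point := by
  obtain ⟨n, hn⟩ := ENat.ne_top_iff_exists.1 ((le_iSup M.stateDepth m).trans_lt hM).ne
  obtain ⟨l, hl, -⟩ := stateDepth_le_iff.1 hn.ge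
  cases hl with
  | nil => rfl
  | cons f hf _ =>
    rcases hf with ⟨hf, -⟩ | ⟨-, hf⟩
    · exact absurd (hf ▸ f.holds) (Set.eq_empty_iff_forall_notMem.1 (h (f.label, true)) f.tgt)
    · exact absurd (hf ▸ f.holds) (Set.eq_empty_iff_forall_notMem.1 (h (f.label, false)) f.src)

end Depth

section Hom

variable {M : LTS.{uP, uI, u} P I} {N : LTS.{uP, uI, v} P I} {L : LTS.{uP, uI, w} P I}

theorem Hom.mem_step (h : Hom M N) {j : I × Bool} {x y : M.State} (hxy : y ∈ M.step j x) :
    h.toFun y ∈ N.step j (h.toFun x) := by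
  obtain ⟨i, _ | _⟩ := j <;> exact h.map_rel _ _ _ hxy

/-- The composite of two homomorphisms, in diagrammatic order. -/
def Hom.comp (g : Hom L M) (h : Hom M N) : Hom L N where
  toFun := h.toFun ∘ g.toFun
  map_point := (congrArg h.toFun g.map_point).trans h.map_point
  map_val p m hm := h.map_val p _ (g.map_val p m hm)
  map_rel i m n hmn := h.map_rel i _ _ (g.map_rel i m n hmn)

/-- Isomorphisms of labeled transition systems. -/
structure Iso (M : LTS.{uP, uI, u} P I) (N : LTS.{uP, uI, v} P I) where
  toEquiv : M.State ≃ N.State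
  map_point : toEquiv M.point = N.point
  val_iff : ∀ p m, M.val p m ↔ N.val p (toEquiv m)
  rel_iff : ∀ i m n, M.rel i m n ↔ N.rel i (toEquiv m) (toEquiv n)

namespace Iso

/-- The inverse of an isomorphism. -/
def symm (e : Iso M N) : Iso N M where
  toEquiv := e.toEquiv.symm
  map_point := e.toEquiv.symm_apply_eq.2 e.map_point.symm
  val_iff p m := by rw [e.val_iff, e.toEquiv.apply_symm_apply]
  rel_iff i m n := by rw [e.rel_iff, e.toEquiv.apply_symm_apply, e.toEquiv.apply_symm_apply]

/-- The composite of two isomorphisms, in diagrammatic order. -/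
def trans (d : Iso L M) (e : Iso M N) : Iso L N where
  toEquiv := d.toEquiv.trans e.toEquiv
  map_point := (congrArg e.toEquiv d.map_point).trans e.map_point
  val_iff p m := (d.val_iff p m).trans (e.val_iff p _)
  rel_iff i m n := (d.rel_iff i m n).trans (e.rel_iff i _ _)

/-- The homomorphism underlying an isomorphism. -/
def toHom (e : Iso M N) : Hom M N where
  toFun := e.toEquiv
  map_point := e.map_point
  map_val p m := (e.val_iff p m).1
  map_rel i m n := (e.rel_iff i m n).1

/-- Isomorphic systems have the same homomorphisms to every system. -/
def homEquiv (e : Iso M N) (L : LTS.{uP, uI, w} P I) : Hom M L ≃ Hom N L where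
  toFun := e.symm.toHom.comp
  invFun := e.toHom.comp
  left_inv h := Hom.ext (funext fun m => congrArg h.toFun (e.toEquiv.symm_apply_apply m))
  right_inv h := Hom.ext (funext fun n => congrArg h.toFun (e.toEquiv.apply_symm_apply n))

theorem acyclic (e : Iso M N) (hN : N.Acyclic) : M.Acyclic :=
  hN.of_injective e.toEquiv.injective fun i m n => (e.rel_iff i m n).1

theorem depth_le (e : Iso M N) : N.depth ≤ M.depth := by
  refine iSup_le fun n => ?_
  calc N.stateDepth n = N.stateDepth (e.toEquiv (e.toEquiv.symm n)) := by
        rw [e.toEquiv.apply_symm_apply]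
    _ ≤ N.stateDepth (e.toEquiv M.point) + M.stateDepth (e.toEquiv.symm n) :=
        stateDepth_map_le (fun i m n => (e.rel_iff i m n).1) _
    _ = M.stateDepth (e.toEquiv.symm n) := by rw [e.map_point, stateDepth_point, zero_add]
    _ ≤ M.depth := le_iSup M.stateDepth _

theorem depth_eq (e : Iso M N) : M.depth = N.depth :=
  le_antisymm e.symm.depth_le e.depth_le

end Iso

end Hom

/-- The system with a single state, which carries the letters `S`, and without transitions. -/
def single (S : Set P) : LTS.{uP, uI, u} P I where
  State := PUnit
  val p _ := p ∈ S
  rel _ _ _ := False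
  point := ⟨⟩

/-- The transitions of `graft`. -/
def graftRel (A : LTS.{uP, uI, u} P I) (j : I × Bool) (B : LTS.{uP, uI, v} P I) (i : I) :
    A.State ⊕ B.State → A.State ⊕ B.State → Prop
  | .inl a, .inl a' => A.rel i a a'
  | .inr b, .inr b' => B.rel i b b'
  | .inl a, .inr b => j = (i, true) ∧ a = A.point ∧ b = B.point
  | .inr b, .inl a => j = (i, false) ∧ a = A.point ∧ b = B.point

/-- The disjoint union of `A` and `B` with a new transition that makes the distinguished state of
`B` a neighbour along `j` of the distinguished state of `A`. -/
def graft (A : LTS.{uP, uI, u} P I) (j : I × Bool) (B : LTS.{uP, uI, v} P I) :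
    LTS.{uP, uI, max u v} P I where
  State := A.State ⊕ B.State
  val p := Sum.elim (A.val p) (B.val p)
  rel := graftRel A j B
  point := .inl A.point

section Graft

variable {A : LTS.{uP, uI, u} P I} {j : I × Bool} {B : LTS.{uP, uI, v} P I}

theorem isCut_graft_inl {S : Set A.State} {i : I} {x y : A.State} (h : A.IsCut S i x y) :
    (A.graft j B).IsCut (Sum.elim id (fun _ => A.point) ⁻¹' S) i (.inl x) (.inl y) := by
  refine ⟨h.1, h.2.1, ?_⟩
  rintro i' (a | b) (a' | b') hrel
  · exact (h.2.2 i' a a' hrel).imp_right fun ⟨hi, hx, hy⟩ => ⟨hi, congrArg _ hx, congrArg _ hy⟩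
  · obtain ⟨-, rfl, -⟩ := hrel
    exact .inl Iff.rfl
  · obtain ⟨-, rfl, -⟩ := hrel
    exact .inl Iff.rfl
  · exact .inl Iff.rfl

theorem isCut_graft_inr {S : Set B.State} {i : I} {x y : B.State} (h : B.IsCut S i x y) :
    (A.graft j B).IsCut (Sum.elim (fun _ => B.point) id ⁻¹' S) i (.inr x) (.inr y) := by
  refine ⟨h.1, h.2.1, ?_⟩
  rintro i' (a | b) (a' | b') hrel
  · exact .inl Iff.rfl
  · obtain ⟨-, -, rfl⟩ := hrel
    exact .inl Iff.rfl
  · obtain ⟨-, -, rfl⟩ := hrel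
    exact .inl Iff.rfl
  · exact (h.2.2 i' b b' hrel).imp_right fun ⟨hi, hx, hy⟩ => ⟨hi, congrArg _ hx, congrArg _ hy⟩

theorem isCut_graft_bridge {i : I} {x y : A.State ⊕ B.State} {S : Set (A.State ⊕ B.State)}
    (h : graftRel A j B i x y) (hS : S = Set.range Sum.inl ∨ S = Set.range Sum.inr) (hx : x ∈ S)
    (hy : y ∉ S) : (A.graft j B).IsCut S i x y := by
  have hA (a a' : A.State) : .inl a ∈ S ↔ .inl a' ∈ S := by rcases hS with rfl | rfl <;> simp
  have hB (b b' : B.State) : .inr b ∈ S ↔ .inr b' ∈ S := by rcases hS with rfl | rfl <;> simp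
  refine ⟨hx, hy, ?_⟩
  rintro i' (a | b) (a' | b') hrel
  · exact .inl (hA a a')
  · change graftRel A j B i' (.inl a) (.inr b') at hrel
    rcases x with x | x <;> rcases y with y | y <;> grind [graftRel]
  · change graftRel A j B i' (.inr b) (.inl a') at hrel
    rcases x with x | x <;> rcases y with y | y <;> grind [graftRel]
  · exact .inl (hB b b')

theorem Acyclic.graft (hA : A.Acyclic) (hB : B.Acyclic) (j : I × Bool) :
    (A.graft j B).Acyclic := by
  refine acyclic_of_exists_isCut ?_
  rintro i (a | b) (a' | b') h
  · exact (hA.exists_isCut h).imp' _ fun _ => isCut_graft_inl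
  · exact ⟨_, isCut_graft_bridge h (.inl rfl) ⟨a, rfl⟩ (by simp)⟩
  · exact ⟨_, isCut_graft_bridge h (.inr rfl) ⟨b, rfl⟩ (by simp)⟩
  · exact (hB.exists_isCut h).imp' _ fun _ => isCut_graft_inr

theorem Acyclic.of_graft_left (h : (A.graft j B).Acyclic) : A.Acyclic :=
  h.of_injective (e := Sum.inl) Sum.inl_injective fun _ _ _ h => h

theorem Acyclic.of_graft_right (h : (A.graft j B).Acyclic) : B.Acyclic :=
  h.of_injective (e := Sum.inr) Sum.inr_injective fun _ _ _ h => h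

theorem point_mem_step_graft : .inr B.point ∈ (A.graft j B).step j (A.graft j B).point := by
  obtain ⟨i, _ | _⟩ := j <;> exact ⟨rfl, rfl, rfl⟩

theorem sumElim_stateDepth_le_stateDepth_graft (x : A.State ⊕ B.State) :
    Sum.elim A.stateDepth (fun b => B.stateDepth b + 1) x ≤ (A.graft j B).stateDepth x := by
  have h := le_add_stateDepth (M := A.graft j B)
    (d := Sum.elim A.stateDepth fun b => B.stateDepth b + 1) ?_ x
  · simpa only [graft, Sum.elim_inl, stateDepth_point, zero_add] using h
  rintro i (a | b) (a' | b') h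
  · exact stateDepth_le_of_rel (M := A) h
  · obtain ⟨-, rfl, rfl⟩ := h
    simp [stateDepth_point]
  · obtain ⟨-, rfl, rfl⟩ := h
    simp [stateDepth_point]
  · obtain ⟨hle, hge⟩ := stateDepth_le_of_rel (M := B) h
    exact ⟨add_le_add_left hle 1, add_le_add_left hge 1⟩

theorem stateDepth_graft_inl (a : A.State) :
    (A.graft j B).stateDepth (.inl a) = A.stateDepth a := by
  refine le_antisymm ?_ (sumElim_stateDepth_le_stateDepth_graft (.inl a))
  have h := stateDepth_map_le (N := A.graft j B) (e := .inl) (fun _ _ _ h => h) a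
  rwa [show Sum.inl A.point = (A.graft j B).point from rfl, stateDepth_point, zero_add] at h

theorem stateDepth_graft_inr (b : B.State) :
    (A.graft j B).stateDepth (.inr b) = B.stateDepth b + 1 := by
  refine le_antisymm ?_ (sumElim_stateDepth_le_stateDepth_graft (.inr b))
  have hpoint : (A.graft j B).stateDepth (.inr B.point) ≤ 1 := by
    simpa only [stateDepth_point, zero_add] using stateDepth_le_of_mem_step point_mem_step_graft
  calc (A.graft j B).stateDepth (.inr b)
      ≤ (A.graft j B).stateDepth (.inr B.point) + B.stateDepth b :=
        stateDepth_map_le (N := A.graft j B) (e := .inr) (fun _ _ _ h => h) b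
    _ ≤ 1 + B.stateDepth b := by gcongr
    _ = B.stateDepth b + 1 := add_comm _ _

theorem depth_graft : (A.graft j B).depth = max A.depth (B.depth + 1) := by
  have : Nonempty B.State := ⟨B.point⟩
  calc (A.graft j B).depth
      = max (⨆ a, (A.graft j B).stateDepth (.inl a)) (⨆ b, (A.graft j B).stateDepth (.inr b)) :=
        iSup_sum
    _ = max A.depth (B.depth + 1) := by
      simp only [stateDepth_graft_inl, stateDepth_graft_inr, depth, ENat.iSup_add]

/-- Grafting respects isomorphisms. -/
def Iso.graft {A' : LTS.{uP, uI, u} P I} {B' : LTS.{uP, uI, v} P I} (d : Iso A A') (e : Iso B B')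
    (j : I × Bool) : Iso (A.graft j B) (A'.graft j B') where
  toEquiv := Equiv.sumCongr d.toEquiv e.toEquiv
  map_point := congrArg Sum.inl d.map_point
  val_iff := by
    rintro p (a | b)
    · exact d.val_iff p a
    · exact e.val_iff p b
  rel_iff := by
    have hd {a} : a = A.point ↔ d.toEquiv a = A'.point := by
      rw [← d.map_point, d.toEquiv.apply_eq_iff_eq]
    have he {b} : b = B.point ↔ e.toEquiv b = B'.point := by
      rw [← e.map_point, e.toEquiv.apply_eq_iff_eq]
    rintro i (a | b) (a' | b')
    · exact d.rel_iff i a a'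
    · exact and_congr_right fun _ => and_congr hd he
    · exact and_congr_right fun _ => and_congr hd he
    · exact e.rel_iff i b b'

end Graft

section HomGraft

variable {A : LTS.{uP, uI, u} P I} {j : I × Bool} {B : LTS.{uP, uI, v} P I}
  {N : LTS.{uP, uI, w} P I} {m : N.State}

/-- The system `M` with distinguished state `m`. -/
def withPoint (M : LTS.{uP, uI, u} P I) (m : M.State) : LTS.{uP, uI, u} P I :=
  { M with point := m }

theorem step_withPoint (m : N.State) : (N.withPoint m).step = N.step := by
  ext ⟨i, _ | _⟩ <;> rfl

theorem sigma_hom_ext {s : Set N.State} {g g' : Σ n : s, Hom B (N.withPoint n)}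
    (h : (g.2.toFun : B.State → N.State) = g'.2.toFun) : g = g' := by
  obtain ⟨⟨n, hn⟩, g⟩ := g
  obtain ⟨⟨n', hn'⟩, g'⟩ := g'
  obtain rfl : n = n' := g.map_point.symm.trans ((congrFun h B.point).trans g'.map_point)
  exact congrArg _ (Hom.ext h)

/-- The restriction of a homomorphism from `A.graft j B` to `A`. -/
def Hom.graftLeft (h : Hom (A.graft j B) N) : Hom A N where
  toFun a := h.toFun (.inl a)
  map_point := h.map_point
  map_val p a := h.map_val p (.inl a)
  map_rel i a a' := h.map_rel i (.inl a) (.inl a')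

/-- The restriction of a homomorphism from `A.graft j B` to `B`, with the image of the distinguished
state of `B`. -/
def Hom.graftRight (h : Hom (A.graft j B) (N.withPoint m)) :
    Σ n : N.step j m, Hom B (N.withPoint n) where
  fst := ⟨h.toFun (.inr B.point), by
    have hstep := h.mem_step point_mem_step_graft
    rwa [h.map_point, step_withPoint] at hstep⟩
  snd :=
    { toFun b := h.toFun (.inr b)
      map_point := rfl
      map_val p b := h.map_val p (.inr b)
      map_rel i b b' := h.map_rel i (.inr b) (.inr b') }

/-- The homomorphism from `A.graft j B` with given restrictions to `A` and `B`. -/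
def Hom.graftElim (g : Hom A (N.withPoint m)) (g' : Σ n : N.step j m, Hom B (N.withPoint n)) :
    Hom (A.graft j B) (N.withPoint m) where
  toFun := Sum.elim g.toFun g'.2.toFun
  map_point := g.map_point
  map_val := by
    rintro p (a | b) h
    · exact g.map_val p a h
    · exact g'.2.map_val p b h
  map_rel := by
    have hstep : (g'.2.toFun B.point : N.State) ∈ N.step j (g.toFun A.point) := by
      rw [g'.2.map_point, g.map_point]
      exact g'.1.2
    rintro i (a | b) (a' | b') h
    · exact g.map_rel i a a' h
    · obtain ⟨rfl, rfl, rfl⟩ := h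
      exact hstep
    · obtain ⟨rfl, rfl, rfl⟩ := h
      exact hstep
    · exact g'.2.map_rel i b b' h

variable (A j B N m) in
/-- A homomorphism from `A.graft j B` consists of homomorphisms from `A` and `B` that send the
distinguished states to neighbours along `j`. -/
def homGraftEquiv : Hom (A.graft j B) (N.withPoint m) ≃
    Hom A (N.withPoint m) × Σ n : N.step j m, Hom B (N.withPoint n) where
  toFun h := ⟨h.graftLeft, h.graftRight⟩
  invFun g := g.1.graftElim g.2
  left_inv h := by
    ext (a | b) <;> rfl
  right_inv g := Prod.ext rfl (sigma_hom_ext rfl)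

theorem subsingleton_hom_single (S : Set P) : Subsingleton (Hom (single S) N) :=
  ⟨fun g g' => Hom.ext (funext fun _ => g.map_point.trans g'.map_point.symm)⟩

theorem nonempty_hom_single_iff {S : Set P} :
    Nonempty (Hom (single S) N) ↔ ∀ p ∈ S, N.val p N.point :=
  ⟨fun ⟨g⟩ p hp => g.map_point ▸ g.map_val p ⟨⟩ hp, fun h =>
    ⟨{ toFun := fun _ => N.point
       map_point := rfl
       map_val := fun p _ hp => h p hp
       map_rel := fun _ _ _ => False.elim }⟩⟩

end HomGraft

section Split

variable {T : LTS.{uP, uI, u} P I}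

/-- The subsystem of `T` with states `S` and distinguished state `s`. -/
def restrict (T : LTS.{uP, uI, u} P I) (S : Set T.State) (s : S) : LTS.{uP, uI, u} P I where
  State := S
  val p m := T.val p m
  rel i m n := T.rel i m n
  point := s

theorem graft_restrict_rel_iff {S : Set T.State} {j : I × Bool} {x y : T.State} (hx : x ∈ S)
    (hy : y ∉ S)
    (hS : ∀ a ∈ S, ∀ b ∉ S, ∀ j', b ∈ T.step j' a ↔ j' = j ∧ a = x ∧ b = y) (i : I)
    (m n : S ⊕ (Sᶜ : Set T.State)) :
    ((T.restrict S ⟨x, hx⟩).graft j (T.restrict Sᶜ ⟨y, hy⟩)).rel i m n ↔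
      T.rel i (Sum.elim Subtype.val Subtype.val m) (Sum.elim Subtype.val Subtype.val n) := by
  have hbridge (a : S) (b : (Sᶜ : Set T.State)) (j' : I × Bool) :
      j = j' ∧ a = ⟨x, hx⟩ ∧ b = ⟨y, hy⟩ ↔ b.1 ∈ T.step j' a := by
    rw [hS a a.2 b b.2, eq_comm, Subtype.ext_iff, Subtype.ext_iff]
  rcases m with a | b <;> rcases n with a' | b'
  · rfl
  · exact hbridge a b' (i, true)
  · exact hbridge a' b (i, false)
  · rfl

theorem Acyclic.exists_iso_graft (hT : T.Acyclic) {j : I × Bool} {y : T.State}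
    (hy : y ∈ T.step j T.point) :
    ∃ A B : LTS.{uP, uI, u} P I, Nonempty (Iso (A.graft j B) T) := by
  classical
  obtain ⟨S, hx, hy, hS⟩ := hT.exists_cut_of_mem_step hy
  exact ⟨T.restrict S ⟨_, hx⟩, T.restrict Sᶜ ⟨y, hy⟩, ⟨{
    toEquiv := Equiv.Set.sumCompl S
    map_point := rfl
    val_iff := by rintro p (m | m) <;> rfl
    rel_iff := fun i m n => by
      have h := graft_restrict_rel_iff hx hy hS i m n
      rcases m with m | m <;> rcases n with n | n <;> exact h }⟩⟩

end Split

end LTS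

namespace Tree

open LTS

/-- The system described by a tree. -/
def toLTS : Tree P I → LTS.{uP, uI, w} P I
  | leaf S => single S
  | graft t j t' => t.toLTS.graft j t'.toLTS

theorem depth_toLTS (t : Tree P I) : (t.toLTS : LTS.{uP, uI, w} P I).depth = t.depth := by
  induction t with
  | leaf S => exact (iSup_unique (ι := PUnit) _).trans stateDepth_point
  | graft t j t' ih ih' =>
    rw [toLTS, depth_graft, ih, ih', depth]
    norm_cast

theorem finite_state_toLTS (t : Tree P I) : Finite (t.toLTS : LTS.{uP, uI, w} P I).State := by
  induction t with
  | leaf S => exact inferInstanceAs (Finite PUnit)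
  | graft t j t' ih ih' => exact inferInstanceAs (Finite (_ ⊕ _))

theorem acyclic_toLTS (t : Tree P I) : (t.toLTS : LTS.{uP, uI, w} P I).Acyclic := by
  induction t with
  | leaf S => exact acyclic_of_exists_isCut fun _ _ _ => False.elim
  | graft t j t' ih ih' => exact ih.graft ih' j

theorem toLTS_mem_connectedAcyclic {t : Tree P I} {k : ℕ} (ht : t.depth ≤ k) :
    t.toLTS ∈ connectedAcyclic.{uP, uI, w} P I k :=
  mem_connectedAcyclic_iff.2
    ⟨t.finite_state_toLTS, t.acyclic_toLTS, t.depth_toLTS.trans_le (Nat.cast_le.2 ht)⟩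

section Count

variable {M : LTS.{uP, uI, u} P I}

theorem finite_hom_toLTS (hM : M.ImageFinite) (t : Tree P I) (m : M.State) :
    Finite (Hom (t.toLTS : LTS.{uP, uI, w} P I) (M.withPoint m)) := by
  induction t generalizing m with
  | leaf S => exact @Finite.of_subsingleton _ (subsingleton_hom_single S)
  | graft t j t' ih ih' =>
    have := hM j m
    have := ih m
    have (n : M.step j m) := ih' n
    exact .of_equiv _ (homGraftEquiv t.toLTS j t'.toLTS M m).symm

theorem homCount_toLTS (hM : M.ImageFinite) (t : Tree P I) (m : M.State) :
    homCount (t.toLTS : LTS.{uP, uI, w} P I) (M.withPoint m) = t.count M m := by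
  induction t generalizing m with
  | leaf S =>
    classical
    have := subsingleton_hom_single (N := M.withPoint m) S
    rw [homCount, toLTS, count]
    split_ifs with hm
    · have := nonempty_hom_single_iff (N := M.withPoint m).2 hm
      exact Nat.card_unique
    · have := not_nonempty_iff.1 (nonempty_hom_single_iff (N := M.withPoint m).not.2 hm)
      exact Nat.card_of_isEmpty
  | graft t j t' ih ih' =>
    have := hM j m
    have := Fintype.ofFinite (M.step j m)
    have (n : M.step j m) := finite_hom_toLTS.{uP, uI, u, w} hM t' n
    calc homCount (t.toLTS.graft j t'.toLTS) (M.withPoint m)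
        = Nat.card (Hom t.toLTS (M.withPoint m) ×
            Σ n : M.step j m, Hom t'.toLTS (M.withPoint n)) :=
          Nat.card_congr (homGraftEquiv t.toLTS j t'.toLTS M m)
      _ = homCount t.toLTS (M.withPoint m) *
            ∑ n : M.step j m, homCount t'.toLTS (M.withPoint n) := by
          rw [Nat.card_prod, Nat.card_sigma]
          rfl
      _ = (graft t j t').count M m := by
          simp only [ih, ih', count, finsum_eq_sum_of_fintype]

end Count

end Tree

namespace LTS

variable {M : LTS.{uP, uI, u} P I} {N : LTS.{uP, uI, v} P I} {T : LTS.{uP, uI, w} P I} {k : ℕ}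

theorem Acyclic.exists_iso_toLTS [Finite T.State] (hT : T.Acyclic) (hdepth : T.depth < ⊤) :
    ∃ t : Tree P I, Nonempty (Iso (t.toLTS : LTS.{uP, uI, w} P I) T) := by
  induction hcard : Nat.card T.State using Nat.strong_induction_on generalizing T with
  | _ c ih =>
    subst hcard
    by_cases hstep : ∀ j, T.step j T.point = ∅
    · have hpoint := eq_point_of_forall_step_eq_empty hstep hdepth
      let : Unique T.State := ⟨⟨T.point⟩, hpoint⟩
      exact ⟨.leaf {p | T.val p T.point}, ⟨{
        toEquiv := Equiv.ofUnique PUnit T.State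
        map_point := rfl
        val_iff := fun _ _ => Iff.rfl
        rel_iff := fun i _ _ =>
          iff_of_false id (Set.eq_empty_iff_forall_notMem.1 (hstep (i, true)) T.point) }⟩⟩
    · push Not at hstep
      obtain ⟨j, y, hy⟩ := hstep
      obtain ⟨A, B, ⟨e⟩⟩ := hT.exists_iso_graft hy
      rw [← e.depth_eq, depth_graft, max_lt_iff] at hdepth
      have : Finite (A.State ⊕ B.State) := .of_equiv _ e.toEquiv.symm
      have : Finite A.State := .of_injective _ (Sum.inl_injective (β := B.State))
      have : Finite B.State := .of_injective _ (Sum.inr_injective (α := A.State))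
      have hcard : Nat.card T.State = Nat.card A.State + Nat.card B.State :=
        (Nat.card_congr e.toEquiv).symm.trans Nat.card_sum
      have hA : 0 < Nat.card A.State := Nat.card_pos_iff.2 ⟨⟨A.point⟩, inferInstance⟩
      have hB : 0 < Nat.card B.State := Nat.card_pos_iff.2 ⟨⟨B.point⟩, inferInstance⟩
      obtain ⟨t, ⟨d⟩⟩ := ih _ (by lia) (e.acyclic hT).of_graft_left hdepth.1 rfl
      obtain ⟨t', ⟨d'⟩⟩ := ih _ (by lia) (e.acyclic hT).of_graft_right
        (le_self_add.trans_lt hdepth.2) rfl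
      exact ⟨.graft t j t', ⟨(d.graft d' j).trans e⟩⟩

theorem exists_iso_toLTS_of_mem_connectedAcyclic (hT : T ∈ connectedAcyclic P I k) :
    ∃ t : Tree P I, t.depth ≤ k ∧ Nonempty (Iso (t.toLTS : LTS.{uP, uI, w} P I) T) := by
  obtain ⟨_, hacyc, hk⟩ := mem_connectedAcyclic_iff.1 hT
  obtain ⟨t, ⟨e⟩⟩ := hacyc.exists_iso_toLTS (hk.trans_lt (ENat.natCast_lt_top k))
  exact ⟨t, by rwa [← e.depth_eq, t.depth_toLTS, Nat.cast_le] at hk, ⟨e⟩⟩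

theorem ImageFinite.finite_hom (hM : M.ImageFinite) (hT : T ∈ connectedAcyclic P I k) :
    Finite (Hom T M) := by
  obtain ⟨t, -, ⟨e⟩⟩ := exists_iso_toLTS_of_mem_connectedAcyclic hT
  have : Finite (Hom t.toLTS M) := t.finite_hom_toLTS hM M.point
  exact .of_equiv _ (e.homEquiv M)

theorem leftProfile_eq_iff_forall_count_eq (hM : M.ImageFinite) (hN : N.ImageFinite) :
    leftProfile (connectedAcyclic.{uP, uI, w} P I k) M =
        leftProfile (connectedAcyclic.{uP, uI, w} P I k) N ↔
      ∀ t : Tree P I, t.depth ≤ k → t.count M M.point = t.count N N.point := by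
  refine ⟨fun h t ht => ?_, fun h => funext fun T => ?_⟩
  · rw [← t.homCount_toLTS hM M.point, ← t.homCount_toLTS hN N.point]
    exact congrFun h ⟨t.toLTS, Tree.toLTS_mem_connectedAcyclic ht⟩
  · obtain ⟨t, ht, ⟨e⟩⟩ := exists_iso_toLTS_of_mem_connectedAcyclic T.2
    calc homCount T.1 M = homCount t.toLTS M := Nat.card_congr (e.symm.homEquiv M)
      _ = t.count M M.point := t.homCount_toLTS hM M.point
      _ = t.count N N.point := h t ht
      _ = homCount t.toLTS N := (t.homCount_toLTS hN N.point).symm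
      _ = homCount T.1 N := Nat.card_congr (e.homEquiv N)

theorem leftProfile_eq_iff_gradedBisim (hM : M.ImageFinite) (hN : N.ImageFinite) :
    leftProfile (connectedAcyclic.{uP, uI, w} P I k) M =
        leftProfile (connectedAcyclic.{uP, uI, w} P I k) N ↔
      GradedBisim M N k M.point N.point :=
  (leftProfile_eq_iff_forall_count_eq hM hN).trans
    ⟨GradedBisim.of_count_eq hM hN, fun h _ => h.count_eq⟩

theorem modalEquiv_iff_gradedBisim (hM : M.ImageFinite) (hN : N.ImageFinite) :
    ModalEquiv k M N ↔ GradedBisim M N k M.point N.point :=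
  ⟨GradedBisim.of_satAt_iff hM hN, fun h _ => h.satAt_iff⟩

end LTS

end ModalHom

open ModalHom in
theorem mainTheorem5_general {P : Type uP} {I : Type uI}
    (M : LTS.{uP, uI, u} P I) (N : LTS.{uP, uI, v} P I)
    (hM : M.ImageFinite) (hN : N.ImageFinite) (k : ℕ) :
    (∀ T ∈ LTS.connectedAcyclic.{uP, uI, w} P I k,
      Finite (LTS.Hom T M) ∧ Finite (LTS.Hom T N)) ∧
    (LTS.leftProfile (LTS.connectedAcyclic.{uP, uI, w} P I k) M =
        LTS.leftProfile (LTS.connectedAcyclic.{uP, uI, w} P I k) N ↔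
      LTS.ModalEquiv k M N) := by
  refine ⟨fun T hT => ⟨hM.finite_hom hT, hN.finite_hom hT⟩, ?_⟩
  calc LTS.leftProfile (LTS.connectedAcyclic.{uP, uI, w} P I k) M =
        LTS.leftProfile (LTS.connectedAcyclic.{uP, uI, w} P I k) N
      ↔ GradedBisim M N k M.point N.point := LTS.leftProfile_eq_iff_gradedBisim hM hN
    _ ↔ LTS.ModalEquiv k M N := (LTS.modalEquiv_iff_gradedBisim hM hN).symm

/-- The left profiles restricted to finite connected acyclic systems of depth at most `k` are
well defined (all the sets of homomorphisms are finite), and they agree exactly when the two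
systems are equivalent in graded modal logic with graded backward modalities up to depth `k`. -/
theorem mainTheorem5 {P : Type uP} {I : Type uI} [Finite P] [Finite I]
    (M : ModalHom.LTS.{uP, uI, u} P I) (N : ModalHom.LTS.{uP, uI, v} P I)
    (hM : M.DegreeFinite) (hN : N.DegreeFinite) (k : ℕ) :
    (∀ T ∈ ModalHom.LTS.connectedAcyclic.{uP, uI, w} P I k,
      Finite (ModalHom.LTS.Hom T M) ∧ Finite (ModalHom.LTS.Hom T N)) ∧
    (ModalHom.LTS.leftProfile (ModalHom.LTS.connectedAcyclic.{uP, uI, w} P I k) M =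
        ModalHom.LTS.leftProfile (ModalHom.LTS.connectedAcyclic.{uP, uI, w} P I k) N ↔
      ModalHom.LTS.ModalEquiv k M N) :=
  mainTheorem5_general M N hM.imageFinite hN.imageFinite k
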